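/- Let $\mathbf{S}=\mathbf{R}/\mathbf{Z}$ be the circle. Let $\widehat{\mathrm{PC}^{\bowtie}}(\mathbf{S})$ be the group of all permutations of $\mathbf{S}$ that are continuous outside a finite subset (this set of permutations is stable under composition and inversion), let $\mathfrak{S}_{\mathrm{fin}}(\mathbf{S})$ be its normal subgroup of finitely supported permutations of $\mathbf{S}$, let $\mathrm{PC}^{\bowtie}(\mathbf{S})=\widehat{\mathrm{PC}^{\bowtie}}(\mathbf{S})/\mathfrak{S}_{\mathrm{fin}}(\mathbf{S})$ be the quotient group, and let $\pi:\widehat{\mathrm{PC}^{\bowtie}}(\mathbf{S})\to\mathrm{PC}^{\bowtie}(\mathbf{S})$ be the quotient homomorphism. A subgroup $\Gamma$ of $\mathrm{PC}^{\bowtie}(\mathbf{S})$ is called realizable if there exists a subgroup $\Lambda$ of $\widehat{\mathrm{PC}^{\bowtie}}(\mathbf{S})$ such that $\pi$ restricts to a bijection from $\Lambda$ onto $\Gamma$. Theorem. Every finitely generated abelian subgroup $A$ of $\mathrm{PC}^{\bowtie}(\mathbf{S})$ is realizable. -/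

import Mathlib

open Set Filter Topology

/-- A continuous injective real function on `[a, b]` sends `[a, b]` to a neighbourhood of the image
of any interior point. -/
theorem image_Icc_mem_nhds_of_injOn {g : ℝ → ℝ} {a b t : ℝ} (hat : a < t) (htb : t < b)
    (hc : ContinuousOn g (Icc a b)) (hi : InjOn g (Icc a b)) : g '' Icc a b ∈ 𝓝 (g t) := by
  have hab : a ≤ b := (hat.trans htb).le
  have ha : a ∈ Icc a b := ⟨le_rfl, hab⟩
  have hb : b ∈ Icc a b := ⟨hab, le_rfl⟩
  have ht : t ∈ Icc a b := ⟨hat.le, htb.le⟩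
  rcases hc.strictMonoOn_of_injOn_Icc' hab hi with h | h
  · exact mem_of_superset (Icc_mem_nhds (h ha ht hat) (h ht hb htb)) (intermediate_value_Icc hab hc)
  · exact mem_of_superset (Icc_mem_nhds (h ht hb htb) (h ha ht hat)) (intermediate_value_Icc' hab hc)

/-- If a permutation of the circle is continuous near `x`, its inverse is continuous at the image
of `x`. -/
theorem continuousAt_symm_of_eventually (f : Equiv.Perm UnitAddCircle) (x : UnitAddCircle)
    (h : ∀ᶠ y in 𝓝 x, ContinuousAt f y) : ContinuousAt f.symm (f x) := by
  obtain ⟨t₀, rfl⟩ := QuotientAddGroup.mk_surjective x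
  obtain ⟨s₀, hs₀⟩ := QuotientAddGroup.mk_surjective (f (t₀ : UnitAddCircle))
  intro U hU
  rw [Equiv.symm_apply_apply] at hU
  rw [mem_map]
  let e₁ := AddCircle.openPartialHomeomorphCoe (1 : ℝ) (t₀ - 1 / 2)
  let e₂ := AddCircle.openPartialHomeomorphCoe (1 : ℝ) (s₀ - 1 / 2)
  have ht₀ : t₀ ∈ e₁.source := by
    constructor <;> linarith
  have hs₀' : s₀ ∈ e₂.source := by
    constructor <;> linarith
  have hcoe : Continuous (fun t : ℝ => (t : UnitAddCircle)) := AddCircle.continuous_mk' 1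
  have hfx : f (t₀ : UnitAddCircle) ∈ e₂.target := by
    rw [← hs₀]; exact e₂.map_source hs₀'
  have hev : ∀ᶠ t : ℝ in 𝓝 t₀, t ∈ e₁.source ∧ ContinuousAt f (t : UnitAddCircle) ∧
      f (t : UnitAddCircle) ∈ e₂.target ∧ (t : UnitAddCircle) ∈ U := by
    have hct : ContinuousAt (fun t : ℝ => f (t : UnitAddCircle)) t₀ :=
      ContinuousAt.comp (f := fun t : ℝ => (t : UnitAddCircle)) (g := f)
        h.self_of_nhds hcoe.continuousAt
    refine Filter.Eventually.and (e₁.open_source.mem_nhds ht₀)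
      (((hcoe.tendsto t₀).eventually h).and ?_)
    exact (hct.eventually (e₂.open_target.mem_nhds hfx)).and ((hcoe.tendsto t₀).eventually hU)
  obtain ⟨ε, hε, hball⟩ := Metric.nhds_basis_closedBall.eventually_iff.1 hev
  rw [Real.closedBall_eq_Icc] at hball
  have hc : ContinuousOn (fun t : ℝ => e₂.symm (f (t : UnitAddCircle))) (Icc (t₀ - ε) (t₀ + ε)) := by
    intro t ht
    obtain ⟨_, h2, h3, _⟩ := hball ht
    have h4 : ContinuousAt (fun t : ℝ => f (t : UnitAddCircle)) t :=
      ContinuousAt.comp (f := fun t : ℝ => (t : UnitAddCircle)) (g := f) h2 hcoe.continuousAt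
    exact (ContinuousAt.comp (g := e₂.symm) (f := fun t : ℝ => f (t : UnitAddCircle))
      (e₂.continuousAt_symm h3) h4).continuousWithinAt
  have hi : InjOn (fun t : ℝ => e₂.symm (f (t : UnitAddCircle))) (Icc (t₀ - ε) (t₀ + ε)) := by
    intro t ht t' ht' htt
    exact e₁.injOn (hball ht).1 (hball ht').1
      (f.injective (e₂.symm.injOn (hball ht).2.2.1 (hball ht').2.2.1 htt))
  have key := image_Icc_mem_nhds_of_injOn (t := t₀) (by linarith) (by linarith) hc hi
  have key2 := e₂.image_mem_nhds (e₂.map_target hfx) key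
  rw [e₂.right_inv hfx] at key2
  refine mem_of_superset key2 ?_
  rintro _ ⟨_, ⟨t, ht, rfl⟩, rfl⟩
  have h5 : e₂ (e₂.symm (f (t : UnitAddCircle))) = f (t : UnitAddCircle) :=
    e₂.right_inv (hball ht).2.2.1
  change f.symm (e₂ (e₂.symm (f (t : UnitAddCircle)))) ∈ U
  rw [h5, Equiv.symm_apply_apply]
  exact (hball ht).2.2.2

/-- The group of permutations of the circle `ℝ/ℤ` that are continuous outside a finite subset. -/
def PCHat : Subgroup (Equiv.Perm UnitAddCircle) where
  carrier := {f | ∃ F : Finset UnitAddCircle, ∀ x ∉ F, ContinuousAt f x}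
  one_mem' := ⟨∅, fun _ _ => continuousAt_id⟩
  mul_mem' := by
    classical
    rintro f g ⟨F, hF⟩ ⟨G, hG⟩
    refine ⟨G ∪ F.image g.symm, fun x hx => ?_⟩
    rw [Finset.mem_union, not_or] at hx
    have h1 : g x ∉ F := fun h => hx.2 (Finset.mem_image.2 ⟨g x, h, g.symm_apply_apply x⟩)
    exact ContinuousAt.comp (g := f) (f := g) (hF _ h1) (hG x hx.1)
  inv_mem' := by
    classical
    rintro f ⟨F, hF⟩
    refine ⟨F.image f, fun y hy => ?_⟩
    have h1 : f.symm y ∉ F := fun h => hy (Finset.mem_image.2 ⟨_, h, f.apply_symm_apply y⟩)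
    have h2 : ∀ᶠ z in 𝓝 (f.symm y), ContinuousAt f z := by
      filter_upwards [F.finite_toSet.isClosed.isOpen_compl.mem_nhds h1] with z hz
      exact hF z hz
    have h3 := continuousAt_symm_of_eventually f _ h2
    rwa [Equiv.apply_symm_apply] at h3

/-- The group of finitely supported permutations of a set `X`. -/
def finSuppPerm (X : Type*) : Subgroup (Equiv.Perm X) where
  carrier := {f | {x | f x ≠ x}.Finite}
  one_mem' := by simp
  mul_mem' := by
    intro f g hf hg
    exact (hf.union hg).subset (Equiv.Perm.set_support_mul_subset f g)
  inv_mem' := by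
    intro f hf
    have h : {x | f⁻¹ x ≠ x} = {x | f x ≠ x} := Equiv.Perm.set_support_symm_eq f
    change {x | f⁻¹ x ≠ x}.Finite
    rw [h]
    exact hf

instance finSuppPerm_normal (X : Type*) : (finSuppPerm X).Normal where
  conj_mem := by
    intro f hf g
    refine (Set.Finite.image g hf).subset fun x hx => ⟨g⁻¹ x, ?_, by simp⟩
    intro h
    apply hx
    change g (f (g⁻¹ x)) = x
    rw [h]
    exact g.apply_symm_apply x

/-- Finitely supported permutations of the circle are continuous outside a finite subset. -/
theorem finSuppPerm_le_PCHat : finSuppPerm UnitAddCircle ≤ PCHat := by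
  intro f hf
  have hf' : {x | f x ≠ x}.Finite := hf
  refine ⟨hf'.toFinset, fun x hx => ?_⟩
  rw [Set.Finite.mem_toFinset] at hx
  have h : (id : UnitAddCircle → UnitAddCircle) =ᶠ[𝓝 x] f := by
    filter_upwards [hf'.isClosed.isOpen_compl.mem_nhds hx] with z hz
    exact (not_not.1 hz).symm
  exact continuousAt_id.congr h

/-- The group of piecewise continuous permutations of the circle up to finite indeterminacy: the
quotient of `PCHat` by its normal subgroup of finitely supported permutations. -/
abbrev PC : Type := PCHat ⧸ (finSuppPerm UnitAddCircle).subgroupOf PCHat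

/-- The quotient group homomorphism. -/
def PC.proj : PCHat →* PC := QuotientGroup.mk' ((finSuppPerm UnitAddCircle).subgroupOf PCHat)

/-- A subgroup `Γ` of `PC` is realizable if it lifts to `PCHat`: some subgroup `Λ` of `PCHat` is
mapped bijectively onto `Γ` by the quotient homomorphism. -/
def PC.Realizable (Γ : Subgroup PC) : Prop :=
  ∃ Λ : Subgroup PCHat, Set.BijOn PC.proj (Λ : Set PCHat) (Γ : Set PC)

/-!
The obstruction to lifting disappears after doubling the circle: a piecewise continuous permutation
`f` acts on the set of one-sided punctured neighbourhoods `x⁺`, `x⁻` of points of the circle, seen as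
filters, by `Filter.map`, and finitely supported permutations act trivially. Hence `A` acts on
`P = UnitAddCircle × Bool`. For each `a` in `A`, the involution `m : x⁺ ↔ x⁻` commutes with `a` at all
but finitely many points, and `m p = a • p` holds at finitely many points only (`finite_flips`), since
a decreasing function has few fixed points.

It remains to recover an action on the circle (`exists_hom_perm_near`). Let `B` be the union of the
finitely many orbits containing a pair `x⁺`, `x⁻` separated by a generator. Off `B` the action descends
to the quotient by `m`. On `B` one looks for an invariant subset containing exactly one of `x⁺` and
`x⁻` for almost all `x`. By Neumann's covering lemma some `t` in `A` acts freely on all the infinite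
orbits in `B` (`exists_freeAt`). Along `t ^ n • p`, for `n → ∞`, the orbit of `m (t ^ n • p)` is
eventually constant and depends on the orbit of `p` only; this gives an involution of the set of
`t`-free orbits, without fixed points by the finiteness of the flips. Another such involution comes
from `n → -∞`. Two fixed-point-free involutions have a common two-colouring
(`exists_coloring_of_involutive`), and the set of points `p` with the same colour as `m p` is then
almost `t`-invariant and finite on each `t`-line, hence finite (`exists_invariant_coloring`). One of the
two colours leaves at least as many points of the circle uncovered as it covers twice. Moving one
side of each of the latter to an uncovered point makes the invariant subset inject into the circle,
with the remaining points fixed.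
-/

/-! ### Matching the ends of orbits -/

/-- Two fixed-point-free involutions have a common two-colouring: the graph with edges `{q, σ q}` and
`{q, τ q}` is a union of even cycles and lines. -/
theorem exists_coloring_of_involutive {Q : Type*} {σ τ : Q → Q} (hσ : Function.Involutive σ)
    (hτ : Function.Involutive τ) (hσ' : ∀ q, σ q ≠ q) (hτ' : ∀ q, τ q ≠ q) :
    ∃ c : Q → Prop, ∀ q, (c (σ q) ↔ ¬ c q) ∧ (c (τ q) ↔ ¬ c q) := by
  -- `σ` and `τ` induce the same fixed-point-free involution on the cycles of the rotation `σ ∘ τ`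
  set s : Equiv.Perm Q := hσ.toPerm with hs
  set u : Equiv.Perm Q := hτ.toPerm with hu
  have hss : s * s = 1 := by ext q; exact hσ q
  have huu : u * u = 1 := by ext q; exact hτ q
  have hsi : s⁻¹ = s := inv_eq_of_mul_eq_one_left hss
  have hui : u⁻¹ = u := inv_eq_of_mul_eq_one_left huu
  set r : Equiv.Perm Q := s * u with hr
  have hsr : ∀ n : ℤ, s * r ^ n = r ^ (-n) * s := by
    intro n
    have h1 : s * r * s⁻¹ = r⁻¹ := by
      rw [hr, mul_inv_rev, hsi, hui, ← mul_assoc, hss, one_mul]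
    have h2 : s * r ^ n * s⁻¹ = r ^ (-n) := by
      rw [← conj_zpow, h1, inv_zpow, zpow_neg]
    rw [← h2, inv_mul_cancel_right]
  have hur : u = s * r := by rw [hr, ← mul_assoc, hss, one_mul]
  let Z := Quotient (Equiv.Perm.SameCycle.setoid r)
  let ι : Z → Z := Quotient.map σ (by
    rintro x y ⟨n, hn⟩
    refine ⟨-n, ?_⟩
    have := congrArg (fun f : Equiv.Perm Q => f x) (hsr n)
    simp only [Equiv.Perm.mul_apply, hn] at this
    exact this.symm)
  have hι : ∀ z, ι (ι z) = z := by
    rintro ⟨q⟩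
    exact congrArg (Quotient.mk _) (hσ q)
  have hι' : ∀ z, ι z ≠ z := by
    rintro ⟨q⟩ h
    obtain ⟨n, hn⟩ : r.SameCycle q (σ q) := Quotient.exact h.symm
    have hn' : (r ^ n) q = s q := hn
    rcases Int.even_or_odd' n with ⟨k, rfl | rfl⟩
    · -- the reflection `σ` fixes the middle of a rotation by an even power
      apply hσ' ((r ^ k) q)
      change (s * r ^ k) q = _
      rw [hsr, Equiv.Perm.mul_apply, ← hn', ← Equiv.Perm.mul_apply, ← zpow_add]
      congr 2; ring
    · apply hτ' ((r ^ k) q)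
      change (u * r ^ k) q = _
      rw [hur, mul_assoc, ← zpow_one_add, hsr, Equiv.Perm.mul_apply, ← hn',
        ← Equiv.Perm.mul_apply, ← zpow_add]
      congr 2; ring
  let : LinearOrder Z := IsWellOrder.linearOrder WellOrderingRel
  have hc : ∀ z : Z, ι z < ι (ι z) ↔ ¬ z < ι z := by
    intro z
    rw [hι, not_lt]
    exact ⟨le_of_lt, fun h => lt_of_le_of_ne h (hι' z)⟩
  refine ⟨fun q => (Quotient.mk _ q : Z) < ι (Quotient.mk _ q), fun q => ⟨hc (Quotient.mk _ q), ?_⟩⟩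
  have h1 : (Quotient.mk _ (τ q) : Z) = ι (Quotient.mk _ q) := by
    refine Quotient.sound ⟨1, ?_⟩
    change (r * u) q = s q
    rw [hr, mul_assoc, huu, mul_one]
  change (Quotient.mk _ (τ q) : Z) < ι (Quotient.mk _ (τ q)) ↔ _
  rw [h1]
  exact hc (Quotient.mk _ q)

section Coloring

variable {A P : Type*} [CommGroup A] [MulAction A P]

/-- The element `t` acts freely on its orbit through `p`. -/
def FreeAt (t : A) (p : P) : Prop := ∀ n : ℤ, t ^ n • p = p → n = 0

theorem FreeAt.inv {t : A} {p : P} (h : FreeAt t p) : FreeAt t⁻¹ p := by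
  intro n hn
  have := h (-n) (by rwa [zpow_neg, ← inv_zpow])
  omega

theorem FreeAt.smul {t : A} {p : P} (h : FreeAt t p) (a : A) : FreeAt t (a • p) := by
  intro n hn
  rw [smul_comm] at hn
  exact h n (smul_left_cancel a hn)

theorem FreeAt.of_mem_orbit {t : A} {p q : P} (h : FreeAt t p) (hq : q ∈ MulAction.orbit A p) :
    FreeAt t q := by
  obtain ⟨a, rfl⟩ := hq
  exact h.smul a

theorem FreeAt.injective {t : A} {p : P} (h : FreeAt t p) :
    Function.Injective fun n : ℕ => t ^ n • p := by
  intro i j hij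
  have h1 : t ^ ((i : ℤ) - j) • p = p := by
    have hij' : t ^ i • p = t ^ j • p := hij
    rw [sub_eq_add_neg, add_comm, zpow_add, mul_smul, zpow_natCast, hij', zpow_neg, zpow_natCast,
      inv_smul_smul]
  have := h _ h1
  omega

theorem FreeAt.eventually {t : A} {p : P} (h : FreeAt t p) {F : Set P} (hF : F.Finite) :
    ∀ᶠ n : ℕ in atTop, t ^ n • p ∉ F := by
  rw [← Nat.cofinite_eq_atTop]
  exact h.injective.tendsto_cofinite.eventually hF.compl_mem_cofinite

/-- The forward end of the `t`-line through `p` is matched by `m` with the orbit of `q`. -/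
def EndMatched (m : P → P) (t : A) (p q : P) : Prop :=
  ∀ᶠ n : ℕ in atTop, m (t ^ n • p) ∈ MulAction.orbit A q

variable {m : P → P} {t : A} {p q : P}

/-- Far along a free `t`-line, `m` commutes with `t` exactly. -/
theorem FreeAt.exists_map_pow_smul (hm : ∀ a : A, {p | m (a • p) ≠ a • m p}.Finite)
    (h : FreeAt t p) : ∃ n₀ : ℕ, ∀ k ≥ n₀, ∀ n : ℕ, m (t ^ (n + k) • p) = t ^ n • m (t ^ k • p) := by
  obtain ⟨n₀, hn₀⟩ := eventually_atTop.1 (h.eventually (hm t))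
  refine ⟨n₀, fun k hk n => ?_⟩
  induction n with
  | zero => simp
  | succ n ih =>
    have h1 : m (t • t ^ (n + k) • p) = t • m (t ^ (n + k) • p) := not_not.1 (hn₀ (n + k) (by omega))
    rw [pow_succ', mul_smul, ← ih, ← h1, ← mul_smul, ← pow_succ']
    congr 3; ring

/-- Translating by `a` shifts the whole `t`-line past the finitely many points at which `m` and `a`
do not commute, so the matching of ends depends on the orbit of `p` only. -/
theorem EndMatched.smul (hm : ∀ a : A, {p | m (a • p) ≠ a • m p}.Finite) (h : FreeAt t p)
    (hpq : EndMatched m t p q) (a : A) : EndMatched m t (a • p) q := by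
  filter_upwards [hpq, h.eventually (hm a)] with n h1 h2
  have h2 : m (a • t ^ n • p) = a • m (t ^ n • p) := not_not.1 h2
  rw [smul_comm, h2]
  exact MulAction.mem_orbit_of_mem_orbit a h1

theorem EndMatched.unique {q' : P} (h : EndMatched m t p q) (h' : EndMatched m t p q') :
    MulAction.orbit A q = MulAction.orbit A q' := by
  obtain ⟨n, h1, h2⟩ := (h.and h').exists
  rw [← MulAction.orbit_eq_iff.2 h1, MulAction.orbit_eq_iff.2 h2]

theorem FreeAt.exists_endMatched (hmi : Function.Involutive m)
    (hm : ∀ a : A, {p | m (a • p) ≠ a • m p}.Finite) (h : FreeAt t p) :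
    ∃ q, FreeAt t q ∧ EndMatched m t p q := by
  obtain ⟨k, hk⟩ := h.exists_map_pow_smul hm
  have hk := hk k le_rfl
  have key : ∀ n : ℕ, t ^ n • m (t ^ k • p) = m (t ^ k • p) → n = 0 := by
    intro n hn
    rw [← hk] at hn
    have := h.injective (hmi.injective hn)
    omega
  refine ⟨m (t ^ k • p), fun n hn => ?_, ?_⟩
  · obtain ⟨j, rfl | rfl⟩ := n.eq_nat_or_neg
    · exact_mod_cast key j (by simpa using hn)
    · rw [zpow_neg, inv_smul_eq_iff, zpow_natCast] at hn
      simpa using key j hn.symm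
  · filter_upwards [eventually_ge_atTop k] with n hn
    obtain ⟨j, rfl⟩ := Nat.exists_eq_add_of_le' hn
    rw [hk]
    exact MulAction.mem_orbit _ _

theorem EndMatched.symm (hmi : Function.Involutive m)
    (hm : ∀ a : A, {p | m (a • p) ≠ a • m p}.Finite) (h : FreeAt t p) (hq : FreeAt t q)
    (hpq : EndMatched m t p q) : EndMatched m t q p := by
  obtain ⟨n₀, hn₀⟩ := h.exists_map_pow_smul hm
  obtain ⟨k, hk, b, hb⟩ := ((eventually_ge_atTop n₀).and hpq).exists
  have hb : b • q = m (t ^ k • p) := hb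
  have h1 : EndMatched m t (b • q) p := by
    refine Eventually.of_forall fun n => ?_
    rw [hb, ← hn₀ k hk, hmi]
    exact MulAction.mem_orbit _ _
  simpa using h1.smul hm (hq.smul b) b⁻¹

/-- An orbit whose end is matched with itself would have `m p = a • p` for one `a` and infinitely many
`p`. -/
theorem FreeAt.not_endMatched_self (hm : ∀ a : A, {p | m (a • p) ≠ a • m p}.Finite)
    (hf : ∀ a : A, {p | a • p = m p}.Finite) (h : FreeAt t p) : ¬ EndMatched m t p p := by
  intro hpp
  obtain ⟨n₀, hn₀⟩ := h.exists_map_pow_smul hm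
  obtain ⟨k, hk, b, hb⟩ := ((eventually_ge_atTop n₀).and hpp).exists
  have hb : b • p = m (t ^ k • p) := hb
  obtain ⟨n, hn, hnk⟩ :=
    ((h.eventually (hf (b * (t ^ k)⁻¹))).and (eventually_ge_atTop k)).exists
  obtain ⟨j, rfl⟩ := Nat.exists_eq_add_of_le' hnk
  apply hn
  change (b * (t ^ k)⁻¹) • t ^ (j + k) • p = _
  rw [hn₀ k hk, ← hb, ← mul_smul, ← mul_smul, pow_add]
  congr 1
  rw [mul_assoc, mul_comm (t ^ j), inv_mul_cancel_left, mul_comm]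

/-- A set which every point leaves in both time directions under iteration of `t`, and which is
`t`-invariant up to finitely many points, is finite. -/
theorem finite_of_eventually_notMem {t : A} {E : Set P} (hE : {p ∈ E | t • p ∉ E}.Finite)
    (h₁ : ∀ p ∈ E, ∃ n : ℕ, t ^ n • p ∉ E) (h₂ : ∀ p ∈ E, ∀ᶠ n : ℕ in atTop, t⁻¹ ^ n • p ∉ E) :
    E.Finite := by
  classical
  have h3 : ∀ q ∈ {p ∈ E | t • p ∉ E}, ((fun n : ℕ => t⁻¹ ^ n • q) '' {n | t⁻¹ ^ n • q ∈ E}).Finite := by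
    intro q hq
    apply Set.Finite.image
    have := h₂ q hq.1
    rw [← Nat.cofinite_eq_atTop] at this
    simpa [eventually_cofinite] using this
  refine (hE.biUnion h3).subset fun p hp => ?_
  have h4 := h₁ p hp
  set n := Nat.find h4 with hn
  have hn0 : n ≠ 0 := by
    intro h0
    have := Nat.find_spec h4
    rw [← hn, h0] at this
    simp [hp] at this
  obtain ⟨k, hk⟩ := Nat.exists_eq_succ_of_ne_zero hn0
  have h5 : t ^ k • p ∈ E := not_not.1 (Nat.find_min h4 (m := k) (by omega))
  have h6 : t • t ^ k • p ∉ E := by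
    have := Nat.find_spec h4
    rwa [← hn, hk, Nat.succ_eq_add_one, pow_succ', mul_smul] at this
  refine mem_biUnion (x := t ^ k • p) ⟨h5, h6⟩ ⟨k, ?_, ?_⟩
  · simpa using hp
  · simp

/-- For an almost equivariant involution `m` which agrees with each group element at finitely many
points only, there is an invariant set separating `p` from `m p` at almost all points `p` on free
`t`-lines: colour the orbits so that the partners at the two ends have the other colour. -/
theorem exists_invariant_coloring (hmi : Function.Involutive m)
    (hm : ∀ a : A, {p | m (a • p) ≠ a • m p}.Finite)
    (hf : ∀ a : A, {p | a • p = m p}.Finite) (t : A) :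
    ∃ c : P → Prop, (∀ (a : A) p, c (a • p) ↔ c p) ∧
      {p | FreeAt t p ∧ (c (m p) ↔ c p)}.Finite := by
  classical
  let Q := {q : MulAction.orbitRel.Quotient A P // FreeAt t q.out}
  have hout : ∀ p : P, (Quotient.mk'' p : MulAction.orbitRel.Quotient A P).out ∈
      MulAction.orbit A p := fun p => by
    have : (MulAction.orbitRel A P).r _ p := Quotient.mk_out (s := MulAction.orbitRel A P) p
    exact this
  have hQ : ∀ q q' : Q, MulAction.orbit A q.1.out = MulAction.orbit A q'.1.out → q = q' := by
    intro q q' h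
    apply Subtype.ext
    rw [← Quotient.out_eq' q.1, ← Quotient.out_eq' q'.1]
    exact Quotient.sound' (MulAction.orbit_eq_iff.1 h)
  -- for `s = t` or `s = t⁻¹`, the ends in the direction of `s` match the free orbits in pairs
  have hinv : ∀ s : A, (∀ p : P, FreeAt t p → FreeAt s p) → (∀ p : P, FreeAt s p → FreeAt t p) →
      ∃ σ : Q → Q, Function.Involutive σ ∧ (∀ q, σ q ≠ q) ∧
        ∀ q, EndMatched m s q.1.out (σ q).1.out := by
    intro s hts hst
    have h1 : ∀ q : Q, ∃ q' : Q, EndMatched m s q.1.out q'.1.out := by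
      intro q
      obtain ⟨x, hx, hqx⟩ := (hts _ q.2).exists_endMatched hmi hm
      refine ⟨⟨Quotient.mk'' x, (hst _ hx).of_mem_orbit (hout x)⟩, ?_⟩
      filter_upwards [hqx] with n hn
      rwa [MulAction.orbit_eq_iff.2 (hout x)]
    choose σ hσ using h1
    refine ⟨σ, fun q => ?_, fun q hq => ?_, hσ⟩
    · exact hQ _ _ ((hσ (σ q)).unique ((hσ q).symm hmi hm (hts _ q.2) (hts _ (σ q).2)))
    · refine (hts _ q.2).not_endMatched_self hm hf (t := s) (m := m) ?_
      have := hσ q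
      rwa [hq] at this
  obtain ⟨σ, hσ, hσ', hσm⟩ := hinv t (fun _ h => h) (fun _ h => h)
  obtain ⟨τ, hτ, hτ', hτm⟩ := hinv t⁻¹ (fun _ h => h.inv) (fun _ h => by simpa using h.inv)
  obtain ⟨c, hc⟩ := exists_coloring_of_involutive hσ hτ hσ' hτ'
  let C : P → Prop := fun p => ∃ q : Q, p ∈ MulAction.orbit A q.1.out ∧ c q
  have hC : ∀ (a : A) p, C (a • p) ↔ C p := by
    intro a p
    simp only [C, ← MulAction.orbit_eq_iff, MulAction.orbit_smul]
  have hCq : ∀ (q : Q) p, p ∈ MulAction.orbit A q.1.out → (C p ↔ c q) := by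
    intro q p hp
    refine ⟨?_, fun h => ⟨q, hp, h⟩⟩
    rintro ⟨q', hp', h⟩
    rwa [hQ q q' (by rw [← MulAction.orbit_eq_iff.2 hp, MulAction.orbit_eq_iff.2 hp'])]
  have hlim : ∀ (s : A) (σ : Q → Q), (∀ p : P, FreeAt t p → FreeAt s p) →
      (∀ q, EndMatched m s q.1.out (σ q).1.out) → (∀ q, c (σ q) ↔ ¬ c q) →
      ∀ p, FreeAt t p → ∀ᶠ n : ℕ in atTop, ¬ (C (m (s ^ n • p)) ↔ C (s ^ n • p)) := by
    intro s σ hts hσm hcσ p hp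
    let q : Q := ⟨Quotient.mk'' p, hp.of_mem_orbit (hout p)⟩
    have hpq : p ∈ MulAction.orbit A q.1.out := MulAction.mem_orbit_symm.1 (hout p)
    obtain ⟨a, ha⟩ := hpq
    have ha : a • q.1.out = p := ha
    have h1 := (hσm q).smul hm (hts _ q.2) a
    rw [ha] at h1
    filter_upwards [h1] with n hn
    rw [hC, hCq _ _ hn, hCq q p ⟨a, ha⟩, hcσ]
    tauto
  refine ⟨C, hC, finite_of_eventually_notMem (t := t) ?_ ?_ ?_⟩
  · refine (hm t).subset ?_
    rintro p ⟨⟨hp, h1⟩, h2⟩ h3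
    refine h2 ⟨hp.smul t, ?_⟩
    rw [h3, hC, hC]
    exact h1
  · rintro p ⟨hp, -⟩
    obtain ⟨n, hn⟩ := (hlim t σ (fun _ h => h) hσm (fun q => (hc q).1) p hp).exists
    exact ⟨n, fun h => hn h.2⟩
  · rintro p ⟨hp, -⟩
    filter_upwards [hlim t⁻¹ τ (fun _ h => h.inv) hτm (fun q => (hc q).2) p hp] with n hn h
    exact hn h.2

end Coloring

/-! ### Free elements and transported actions -/

section FreeElements

variable {A : Type*} [CommGroup A]

/-- The isolator of the stabilizer of `p`: the elements some positive power of which fixes `p`. -/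
def isolatorStabilizer (A : Type*) {P : Type*} [CommGroup A] [MulAction A P] (p : P) :
    Subgroup A where
  carrier := {a | ∃ n : ℕ, n ≠ 0 ∧ a ^ n • p = p}
  one_mem' := ⟨1, one_ne_zero, by simp⟩
  mul_mem' := by
    rintro a b ⟨i, hi, ha⟩ ⟨j, hj, hb⟩
    refine ⟨i * j, mul_ne_zero hi hj, ?_⟩
    have ha' : (a ^ i) ^ j ∈ MulAction.stabilizer A p := pow_mem (show _ ∈ _ from ha) j
    have hb' : (b ^ j) ^ i ∈ MulAction.stabilizer A p := pow_mem (show _ ∈ _ from hb) i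
    have h : (a * b) ^ (i * j) ∈ MulAction.stabilizer A p := by
      rw [mul_pow, pow_mul, mul_comm i j, pow_mul]
      exact mul_mem ha' hb'
    exact h
  inv_mem' := by
    rintro a ⟨i, hi, ha⟩
    refine ⟨i, hi, ?_⟩
    rw [inv_pow, inv_smul_eq_iff, ha]

theorem freeAt_of_notMem_isolatorStabilizer {P : Type*} [MulAction A P] {t : A} {p : P}
    (h : t ∉ isolatorStabilizer A p) : FreeAt t p := by
  intro n hn
  by_contra h0
  apply h
  obtain ⟨j, rfl | rfl⟩ := n.eq_nat_or_neg
  · exact ⟨j, by simpa using h0, by simpa using hn⟩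
  · refine ⟨j, by simpa using h0, ?_⟩
    rw [zpow_neg, inv_smul_eq_iff, zpow_natCast] at hn
    exact hn.symm

/-- If the isolator has finite index, then all elements have a positive power in the stabilizer, and
the quotient by the stabilizer is a finitely generated abelian torsion group. -/
theorem finite_orbit_of_finiteIndex_isolatorStabilizer [Group.FG A] {P : Type*} [MulAction A P]
    {p : P} (h : (isolatorStabilizer A p).FiniteIndex) : (MulAction.orbit A p).Finite := by
  have h1 : Finite (A ⧸ MulAction.stabilizer A p) := by
    apply CommGroup.finite_of_fg_isMulTorsion
    intro g
    obtain ⟨a, rfl⟩ := QuotientGroup.mk_surjective g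
    obtain ⟨n, hn, ha⟩ := (isolatorStabilizer A p).pow_index_mem a
    refine isOfFinOrder_iff_pow_eq_one.2 ⟨(isolatorStabilizer A p).index * n,
      Nat.pos_of_ne_zero (mul_ne_zero h.index_ne_zero hn), ?_⟩
    rw [← QuotientGroup.mk_pow, QuotientGroup.eq_one_iff, pow_mul]
    exact ha
  exact Set.finite_coe_iff.1 (Finite.of_equiv _ (MulAction.orbitEquivQuotientStabilizer A p).symm)

open scoped Pointwise in
/-- By Neumann's covering lemma, one element acts freely on all the infinite orbits in a finite
family. -/
theorem exists_freeAt [Group.FG A] {P : Type*} [MulAction A P] {I : Set P} (hI : I.Finite) :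
    ∃ t : A, ∀ p ∈ I, (MulAction.orbit A p).Finite ∨ FreeAt t p := by
  classical
  by_contra! hcon
  have hcov : ⋃ p ∈ hI.toFinset.filter (fun p => ¬ (MulAction.orbit A p).Finite),
      (1 : A) • (isolatorStabilizer A p : Set A) = univ := by
    refine eq_univ_of_forall fun t => ?_
    obtain ⟨p, hp, h1, h2⟩ := hcon t
    simp only [one_smul]
    refine mem_biUnion (x := p) ?_ ?_
    · simpa using ⟨hp, h1⟩
    · by_contra h3
      exact h2 (freeAt_of_notMem_isolatorStabilizer h3)
  obtain ⟨p, hp, h⟩ := Subgroup.exists_finiteIndex_of_leftCoset_cover hcov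
  exact (Finset.mem_filter.1 hp).2 (finite_orbit_of_finiteIndex_isolatorStabilizer h)

/-- A map `π` on an invariant subset `V` whose fibres are permuted by `A` transports the action to
the image of `V`; extend it trivially. -/
theorem exists_hom_perm_of_fibers {G P X : Type*} [Group G] [MulAction G P] (V : Set P)
    (hV : ∀ (a : G), ∀ p ∈ V, a • p ∈ V) (π : P → X)
    (hπ : ∀ (a : G), ∀ p ∈ V, ∀ q ∈ V, π p = π q → π (a • p) = π (a • q)) :
    ∃ τ : G →* Equiv.Perm X, ∀ (a : G), ∀ p ∈ V, τ a (π p) = π (a • p) := by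
  classical
  let φ : G → X → X := fun a x => if h : ∃ p ∈ V, π p = x then π (a • h.choose) else x
  have hφ : ∀ a, ∀ p ∈ V, φ a (π p) = π (a • p) := by
    intro a p hp
    have h : ∃ q ∈ V, π q = π p := ⟨p, hp, rfl⟩
    simp only [φ, dif_pos h]
    exact hπ a _ h.choose_spec.1 _ hp h.choose_spec.2
  have hφ' : ∀ a x, (¬ ∃ p ∈ V, π p = x) → φ a x = x := fun a x h => dif_neg h
  have hmul : ∀ a b x, φ (a * b) x = φ a (φ b x) := by
    intro a b x
    by_cases h : ∃ p ∈ V, π p = x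
    · obtain ⟨p, hp, rfl⟩ := h
      rw [hφ _ _ hp, hφ _ _ hp, hφ _ _ (hV b p hp), mul_smul]
    · rw [hφ' _ _ h, hφ' _ _ h, hφ' _ _ h]
  have hone : ∀ x, φ 1 x = x := by
    intro x
    by_cases h : ∃ p ∈ V, π p = x
    · obtain ⟨p, hp, rfl⟩ := h
      rw [hφ _ _ hp, one_smul]
    · exact hφ' _ _ h
  let : MulAction G X :=
    { smul := φ
      one_smul := hone
      mul_smul := hmul }
  exact ⟨MulAction.toPermHom G X, hφ⟩

end FreeElements

/-! ### Near permutations of a double cover -/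

section Realization

variable {A X : Type*} [CommGroup A] [MulAction A (X × Bool)]

/-- The involution exchanging the two elements of `X × Bool` over each point of `X`. -/
def otherSide (p : X × Bool) : X × Bool := (p.1, !p.2)

theorem otherSide_involutive : Function.Involutive (otherSide (X := X)) := by
  rintro ⟨x, b⟩
  simp [otherSide]

theorem otherSide_ne (p : X × Bool) : otherSide p ≠ p := by
  obtain ⟨x, b⟩ := p
  simp [otherSide]

theorem eq_otherSide_of_fst_eq {p q : X × Bool} (h : p.1 = q.1) (hne : p ≠ q) :
    p = otherSide q := by
  obtain ⟨x, b⟩ := p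
  obtain ⟨y, c⟩ := q
  obtain rfl : x = y := h
  cases b <;> cases c <;> simp_all [otherSide]

/-- Let a finitely generated abelian group act on `X × Bool`, each element inducing a permutation
of `X` up to finitely many points and exchanging the two sides of finitely many points only. Then
these near permutations of `X` come from an action on `X`. -/
theorem exists_hom_perm_near [Group.FG A] (f : A → X → X)
    (hfst : ∀ a : A, {p : X × Bool | (a • p).1 ≠ f a p.1}.Finite)
    (hflip : ∀ a : A, {p : X × Bool | a • p = otherSide p}.Finite) :
    ∃ τ : A →* Equiv.Perm X, ∀ a, {x | τ a x ≠ f a x}.Finite := by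
  classical
  have heq : ∀ (a : A) (p : X × Bool), (a • otherSide p).1 = (a • p).1 →
      a • otherSide p = otherSide (a • p) := fun a p h =>
    eq_otherSide_of_fst_eq h fun h' => otherSide_ne p (smul_left_cancel a h')
  have hm' : ∀ a : A, {p : X × Bool | (a • otherSide p).1 ≠ (a • p).1}.Finite := by
    intro a
    refine ((hfst a).union ((hfst a).preimage otherSide_involutive.injective.injOn)).subset ?_
    intro p hp
    by_contra h
    rw [mem_union, not_or] at h
    have h1 : (a • p).1 = f a p.1 := not_not.1 h.1
    have h2 : (a • otherSide p).1 = f a p.1 := not_not.1 h.2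
    exact hp (h2.trans h1.symm)
  have hm : ∀ a : A, {p : X × Bool | otherSide (a • p) ≠ a • otherSide p}.Finite := fun a =>
    (hm' a).subset fun p hp h => hp (heq a p h).symm
  obtain ⟨S, hS⟩ := Group.fg_def.1 ‹Group.FG A›
  -- the points whose two sides are separated by a generator
  let I : Set (X × Bool) := ⋃ s ∈ S, {p | (s • otherSide p).1 ≠ (s • p).1}
  have hI : I.Finite := S.finite_toSet.biUnion fun s _ => hm' s
  -- off the invariant set `B`, `A` commutes with the exchange of sides
  let B : Set (X × Bool) := {p | ∃ a : A, a • p ∈ I}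
  have hBa : ∀ (a : A) p, a • p ∈ B ↔ p ∈ B := by
    intro a p
    constructor
    · rintro ⟨b, hb⟩
      exact ⟨b * a, by rwa [mul_smul]⟩
    · rintro ⟨b, hb⟩
      exact ⟨b * a⁻¹, by rwa [mul_smul, inv_smul_smul]⟩
  have hBc : ∀ (a : A) p, p ∉ B → a • otherSide p = otherSide (a • p) := by
    intro a
    have ha : a ∈ Subgroup.closure (S : Set A) := by rw [hS]; trivial
    induction ha using Subgroup.closure_induction with
    | mem s hs =>
      intro p hp
      apply heq
      by_contra h
      exact hp ⟨1, by rw [one_smul]; exact mem_biUnion hs h⟩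
    | one => simp
    | mul a b _ _ iha ihb =>
      intro p hp
      rw [mul_smul, ihb p hp, iha _ (by rwa [hBa]), mul_smul]
    | inv a _ iha =>
      intro p hp
      rw [inv_smul_eq_iff, iha _ (by rwa [hBa]), smul_inv_smul]
  have hIo : ∀ p ∈ I, otherSide p ∈ I := by
    intro p hp
    obtain ⟨s, hs, h⟩ := mem_iUnion₂.1 hp
    refine mem_iUnion₂.2 ⟨s, hs, fun h' => h ?_⟩
    rw [otherSide_involutive p] at h'
    exact h'.symm
  have hBo' : ∀ p, otherSide p ∈ B → p ∈ B := by
    rintro p ⟨a, ha⟩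
    by_contra hp
    rw [hBc a p hp] at ha
    refine hp ⟨a, ?_⟩
    simpa [otherSide_involutive (a • p)] using hIo _ ha
  have hBo : ∀ p, otherSide p ∈ B ↔ p ∈ B := fun p =>
    ⟨hBo' p, fun h => hBo' _ (by rwa [otherSide_involutive p])⟩
  obtain ⟨t, ht⟩ := exists_freeAt (A := A) hI
  obtain ⟨c, hc, hcfin⟩ := exists_invariant_coloring otherSide_involutive hm hflip t
  have hBfin : {p ∈ B | c (otherSide p) ↔ c p}.Finite := by
    have h1 : (⋃ p ∈ {p ∈ I | (MulAction.orbit A p).Finite}, MulAction.orbit A p).Finite :=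
      (hI.subset (sep_subset _ _)).biUnion fun p hp => hp.2
    refine (h1.union hcfin).subset ?_
    rintro p ⟨⟨a, ha⟩, hp⟩
    have hpo : p ∈ MulAction.orbit A (a • p) := MulAction.mem_orbit_symm.1 ⟨a, rfl⟩
    rcases ht _ ha with h | h
    · exact Or.inl (mem_biUnion (x := a • p) ⟨ha, h⟩ hpo)
    · exact Or.inr ⟨h.of_mem_orbit hpo, hp⟩
  -- after replacing `c` by its complement, fewer points have both sides coloured than none
  obtain ⟨c, hc, hBfin, ⟨ι⟩⟩ : ∃ c : X × Bool → Prop, (∀ (a : A) p, c (a • p) ↔ c p) ∧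
      {p ∈ B | c (otherSide p) ↔ c p}.Finite ∧
      Nonempty ({x | (x, true) ∈ B ∧ c (x, true) ∧ c (x, false)} ↪
        {x | (x, true) ∈ B ∧ ¬ c (x, true) ∧ ¬ c (x, false)}) := by
    rcases Function.Embedding.total {x | (x, true) ∈ B ∧ c (x, true) ∧ c (x, false)}
      {x | (x, true) ∈ B ∧ ¬ c (x, true) ∧ ¬ c (x, false)} with h | h
    · exact ⟨c, hc, hBfin, h⟩
    · refine ⟨fun p => ¬ c p, fun a p => not_congr (hc a p), ?_, ?_⟩
      · simpa only [not_iff_not] using hBfin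
      · simpa only [not_not] using h
  have hBt : ∀ x b, (x, b) ∈ B ↔ (x, true) ∈ B := by
    intro x b
    cases b
    · exact hBo (x, true)
    · rfl
  -- Outside `B`, both sides of a point are kept, and project to that point. Inside `B`, the coloured
  -- sides are kept, and one of the two over each point of `D` moves to an uncovered point.
  let V : Set (X × Bool) := {p | p ∈ B → c p}
  let D : Set X := {x | (x, true) ∈ B ∧ c (x, true) ∧ c (x, false)}
  let π : X × Bool → X := fun p => if h : p.1 ∈ D ∧ p.2 = false then ι ⟨p.1, h.1⟩ else p.1
  have hπB : ∀ p, p ∉ B → π p = p.1 := by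
    rintro ⟨x, b⟩ hp
    apply dif_neg
    rintro ⟨h, -⟩
    exact hp ((hBt x b).2 h.1)
  have hπ_mem : ∀ p ∈ B, (π p, true) ∈ B := by
    rintro ⟨x, b⟩ hp
    by_cases h : x ∈ D ∧ b = false
    · have : π (x, b) = ι ⟨x, h.1⟩ := dif_pos h
      rw [this]
      exact (ι ⟨x, h.1⟩).2.1
    · have : π (x, b) = x := dif_neg h
      rw [this]
      exact (hBt x b).1 hp
  have hπi : ∀ p ∈ B, ∀ q ∈ B, c p → c q → π p = π q → p = q := by
    have hcb : ∀ x b, c (x, b) → ∀ y : {x | (x, true) ∈ B ∧ ¬ c (x, true) ∧ ¬ c (x, false)},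
        (y : X) ≠ x := by
      rintro x b h y rfl
      cases b
      · exact y.2.2.2 h
      · exact y.2.2.1 h
    rintro ⟨x, b⟩ hp ⟨y, d⟩ hq hcp hcq h
    by_cases h1 : x ∈ D ∧ b = false <;> by_cases h2 : y ∈ D ∧ d = false
    · have e1 : π (x, b) = ι ⟨x, h1.1⟩ := dif_pos h1
      have e2 : π (y, d) = ι ⟨y, h2.1⟩ := dif_pos h2
      rw [e1, e2] at h
      have := ι.injective (Subtype.ext h)
      rw [Subtype.mk.injEq] at this
      rw [this, h1.2, h2.2]
    · have e1 : π (x, b) = ι ⟨x, h1.1⟩ := dif_pos h1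
      have e2 : π (y, d) = y := dif_neg h2
      rw [e1, e2] at h
      exact absurd h (hcb y d hcq _)
    · have e1 : π (x, b) = x := dif_neg h1
      have e2 : π (y, d) = ι ⟨y, h2.1⟩ := dif_pos h2
      rw [e1, e2] at h
      exact absurd h.symm (hcb x b hcp _)
    · have e1 : π (x, b) = x := dif_neg h1
      have e2 : π (y, d) = y := dif_neg h2
      rw [e1, e2] at h
      subst h
      have hxB := (hBt x b).1 hp
      cases b <;> cases d
      · rfl
      · exact absurd ⟨⟨hxB, hcq, hcp⟩, rfl⟩ h1
      · exact absurd ⟨⟨hxB, hcp, hcq⟩, rfl⟩ h2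
      · rfl
  have hV : ∀ (a : A), ∀ p ∈ V, a • p ∈ V := by
    intro a p hp h
    rw [hc]
    exact hp ((hBa a p).1 h)
  obtain ⟨τ, hτ⟩ := exists_hom_perm_of_fibers V hV π (by
    intro a p hp q hq h
    by_cases hpB : p ∈ B
    · by_cases hqB : q ∈ B
      · rw [hπi p hpB q hqB (hp hpB) (hq hqB) h]
      · have h1 := hπ_mem p hpB
        rw [h, hπB q hqB] at h1
        exact absurd ((hBt q.1 q.2).2 h1) hqB
    · by_cases hqB : q ∈ B
      · have h1 := hπ_mem q hqB
        rw [← h, hπB p hpB] at h1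
        exact absurd ((hBt p.1 p.2).2 h1) hpB
      · rw [hπB p hpB, hπB q hqB] at h
        rw [hπB _ (by rwa [hBa]), hπB _ (by rwa [hBa])]
        by_cases hpq : p = q
        · rw [hpq]
        · rw [eq_otherSide_of_fst_eq h hpq, hBc a q hqB]
          rfl)
  refine ⟨τ, fun a => ?_⟩
  have hπfin : {p ∈ B | c p ∧ π p ≠ p.1}.Finite := by
    refine hBfin.subset ?_
    rintro ⟨x, b⟩ ⟨hp, hcp, h⟩
    refine ⟨hp, ?_⟩
    have h1 : x ∈ D ∧ b = false := by
      by_contra h1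
      exact h (dif_neg h1)
    obtain ⟨h1, rfl⟩ := h1
    exact iff_of_true h1.2.1 h1.2.2
  have hE : ({p | (a • p).1 ≠ f a p.1} ∪ {p ∈ B | c (otherSide p) ↔ c p} ∪
      ({p ∈ B | c p ∧ π p ≠ p.1} ∪ (fun p => a • p) ⁻¹' {p ∈ B | c p ∧ π p ≠ p.1})).Finite :=
    ((hfst a).union hBfin).union
      (hπfin.union (hπfin.preimage (MulAction.injective a).injOn))
  refine (hE.image Prod.fst).subset fun x hx => ?_
  by_contra hcon
  have hgood : ∀ b, (x, b) ∉ _ := fun b hb => hcon ⟨(x, b), hb, rfl⟩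
  simp only [mem_union, not_or] at hgood
  have hfx : ∀ b, (a • (x, b)).1 = f a x := fun b => not_not.1 (hgood b).1.1
  obtain ⟨b, hbV⟩ : ∃ b, (x, b) ∈ V := by
    by_cases hB : (x, true) ∈ B
    · by_cases h : c (x, true)
      · exact ⟨true, fun _ => h⟩
      · refine ⟨false, fun _ => ?_⟩
        by_contra h'
        exact (hgood true).1.2 ⟨hB, iff_of_false h' h⟩
    · exact ⟨true, fun h => absurd h hB⟩
  have h1 : π (x, b) = x := by
    by_cases hB : (x, b) ∈ B
    · by_contra h
      exact (hgood b).2.1 ⟨hB, hbV hB, h⟩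
    · exact hπB _ hB
  have h2 : π (a • (x, b)) = (a • (x, b)).1 := by
    by_cases hB : a • (x, b) ∈ B
    · by_contra h
      exact (hgood b).2.2 ⟨hB, hV a _ hbV hB, h⟩
    · exact hπB _ hB
  have h3 := hτ a _ hbV
  rw [h1, h2, hfx] at h3
  exact hx h3

end Realization

/-! ### Monotone functions and one-sided neighbourhoods -/

/-- A continuous increasing function bounded below has a limit at the left end of its domain and is
open onto right neighbourhoods of this limit. -/
theorem map_nhdsGT_of_strictMonoOn {g : ℝ → ℝ} {a b : ℝ} (hab : a < b)
    (hc : ContinuousOn g (Ioo a b)) (hg : StrictMonoOn g (Ioo a b))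
    (hb : BddBelow (g '' Ioo a b)) : ∃ c, map g (𝓝[>] a) = 𝓝[>] c := by
  set c := sInf (g '' Ioo a b)
  have hlt : ∀ u ∈ Ioo a b, c < g u := by
    intro u hu
    obtain ⟨v, hav, hvu⟩ := exists_between hu.1
    have hv : v ∈ Ioo a b := ⟨hav, hvu.trans hu.2⟩
    exact (csInf_le hb (mem_image_of_mem g hv)).trans_lt (hg hv hu hvu)
  refine ⟨c, le_antisymm ?_ ?_⟩
  · refine tendsto_nhdsWithin_iff.2 ⟨?_, ?_⟩
    · exact hg.monotoneOn.tendsto_nhdsWithin_Ioo_right (nonempty_Ioo.2 hab) hb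
    · filter_upwards [Ioo_mem_nhdsGT hab] with u hu using hlt u hu
  · intro U hU
    obtain ⟨d, had, hd⟩ := (mem_nhdsGT_iff_exists_mem_Ioc_Ioo_subset hab).1 (mem_map.1 hU)
    obtain ⟨e, hae, hed⟩ := exists_between had.1
    have he : e ∈ Ioo a b := ⟨hae, hed.trans_le had.2⟩
    refine mem_of_superset (Ioo_mem_nhdsGT (hlt e he)) fun y hy => ?_
    obtain ⟨_, ⟨u, hu, rfl⟩, huy⟩ := exists_lt_of_csInf_lt ((nonempty_Ioo.2 hab).image g) hy.1
    have hue : u < e := (hg.lt_iff_lt hu he).1 (huy.trans hy.2)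
    have hsub : Icc u e ⊆ Ioo a b := fun v hv => ⟨hu.1.trans_le hv.1, hv.2.trans_lt he.2⟩
    obtain ⟨v, hv, rfl⟩ := intermediate_value_Icc hue.le (hc.mono hsub) ⟨huy.le, hy.2.le⟩
    exact hd ⟨(hsub hv).1, hv.2.trans_lt hed⟩

theorem map_neg_nhdsGT_eq (a : ℝ) : map Neg.neg (𝓝[>] a) = 𝓝[<] (-a) := by
  simp

theorem map_neg_nhdsLT_eq (a : ℝ) : map Neg.neg (𝓝[<] a) = 𝓝[>] (-a) := by
  simp

theorem map_nhdsGT_of_strictAntiOn {g : ℝ → ℝ} {a b : ℝ} (hab : a < b)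
    (hc : ContinuousOn g (Ioo a b)) (hg : StrictAntiOn g (Ioo a b))
    (hb : BddAbove (g '' Ioo a b)) : ∃ c, map g (𝓝[>] a) = 𝓝[<] c := by
  obtain ⟨c, h⟩ := map_nhdsGT_of_strictMonoOn (g := fun u => -g u) hab hc.neg
    (fun u hu v hv huv => neg_lt_neg (hg hu hv huv)) (by
      obtain ⟨M, hM⟩ := hb
      refine ⟨-M, ?_⟩
      rintro _ ⟨u, hu, rfl⟩
      exact neg_le_neg (hM ⟨u, hu, rfl⟩))
  refine ⟨-c, ?_⟩
  rw [← map_neg_nhdsGT_eq, ← h, map_map]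
  congr 1
  ext u
  simp

theorem map_nhdsLT_of_comp_neg {g : ℝ → ℝ} {b : ℝ} {F : Filter ℝ}
    (h : map (fun u => g (-u)) (𝓝[>] (-b)) = F) : map g (𝓝[<] b) = F := by
  rw [← h, ← map_neg_nhdsLT_eq, map_map]
  congr 1
  ext u
  simp

/-! ### One-sided neighbourhoods in the circle -/

/-- The one-sided punctured neighbourhoods of `x` in the circle: on the positive side for
`(x, true)`, on the negative side for `(x, false)`. -/
def oneSided (p : UnitAddCircle × Bool) : Filter UnitAddCircle :=
  map (fun u : ℝ => p.1 + (u : UnitAddCircle)) (if p.2 then 𝓝[>] 0 else 𝓝[<] 0)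

theorem oneSided_true (t : ℝ) :
    oneSided ((t : UnitAddCircle), true) = map (fun u : ℝ => (u : UnitAddCircle)) (𝓝[>] t) := by
  have h := (Homeomorph.addLeft t).isEmbedding.map_nhdsWithin_eq (Ioi 0) 0
  simp only [Homeomorph.coe_addLeft, image_const_add_Ioi, add_zero] at h
  rw [← h, map_map, oneSided, if_pos rfl]
  rfl

theorem oneSided_false (t : ℝ) :
    oneSided ((t : UnitAddCircle), false) = map (fun u : ℝ => (u : UnitAddCircle)) (𝓝[<] t) := by
  have h := (Homeomorph.addLeft t).isEmbedding.map_nhdsWithin_eq (Iio 0) 0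
  simp only [Homeomorph.coe_addLeft, image_const_add_Iio, add_zero] at h
  rw [← h, map_map, oneSided, if_neg (by simp)]
  rfl

instance oneSided_neBot (p : UnitAddCircle × Bool) : (oneSided p).NeBot := by
  obtain ⟨x, b⟩ := p
  obtain ⟨t, rfl⟩ := QuotientAddGroup.mk_surjective x
  cases b
  · exact oneSided_false t ▸ inferInstance
  · exact oneSided_true t ▸ inferInstance

/-- A local inverse of the projection `ℝ → ℝ/ℤ` near `t`. -/
theorem exists_local_inverse (t : ℝ) : ∃ r : UnitAddCircle → ℝ,
    ∀ᶠ u : ℝ in 𝓝 t, r (u : UnitAddCircle) = u := by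
  let e := AddCircle.openPartialHomeomorphCoe (1 : ℝ) (t - 1 / 2)
  have ht : t ∈ e.source := by constructor <;> linarith
  exact ⟨e.symm, by
    filter_upwards [e.open_source.mem_nhds ht] with u hu using e.left_inv hu⟩

theorem oneSided_le_nhdsNE (p : UnitAddCircle × Bool) : oneSided p ≤ 𝓝[≠] p.1 := by
  obtain ⟨x, b⟩ := p
  obtain ⟨t, rfl⟩ := QuotientAddGroup.mk_surjective x
  have h : map (fun u : ℝ => (u : UnitAddCircle)) (𝓝[≠] t) ≤ 𝓝[≠] (t : UnitAddCircle) := by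
    obtain ⟨r, hr⟩ := exists_local_inverse t
    refine tendsto_nhdsWithin_iff.2 ⟨((AddCircle.continuous_mk' 1).tendsto t).mono_left
      nhdsWithin_le_nhds, ?_⟩
    filter_upwards [hr.filter_mono nhdsWithin_le_nhds, self_mem_nhdsWithin] with u hu hut h
    apply hut
    have h : (u : UnitAddCircle) = t := h
    rw [mem_singleton_iff, ← hu, h, hr.self_of_nhds]
  cases b
  · exact (oneSided_false t).le.trans
      ((map_mono (nhdsWithin_mono t fun u (hu : u < t) => ne_of_lt hu)).trans h)
  · exact (oneSided_true t).le.trans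
      ((map_mono (nhdsWithin_mono t fun u (hu : t < u) => ne_of_gt hu)).trans h)

theorem oneSided_le_cofinite (p : UnitAddCircle × Bool) : oneSided p ≤ cofinite := by
  refine (oneSided_le_nhdsNE p).trans fun U hU => ?_
  have h : {p.1}ᶜ ∩ (Uᶜ \ {p.1})ᶜ ∈ 𝓝[≠] p.1 :=
    inter_mem self_mem_nhdsWithin (nhdsWithin_le_nhds
      (((mem_cofinite.1 hU).subset sdiff_subset).isClosed.isOpen_compl.mem_nhds (by simp)))
  refine mem_of_superset h ?_
  rintro y ⟨h1, h2⟩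
  by_contra h3
  exact h2 ⟨h3, h1⟩

/-- Where `f` is continuous, it sends the two sides of a point to sides of the image point. -/
theorem fst_eq_of_map_oneSided_eq {f : UnitAddCircle → UnitAddCircle} {p q : UnitAddCircle × Bool}
    (hf : ContinuousAt f p.1) (h : map f (oneSided p) = oneSided q) : q.1 = f p.1 := by
  have h1 : Tendsto f (oneSided p) (𝓝 (f p.1)) :=
    hf.tendsto.mono_left ((oneSided_le_nhdsNE p).trans nhdsWithin_le_nhds)
  have h2 : Tendsto f (oneSided p) (𝓝 q.1) :=
    h.le.trans ((oneSided_le_nhdsNE q).trans nhdsWithin_le_nhds)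
  exact tendsto_nhds_unique h2 h1

theorem oneSided_injective : Function.Injective oneSided := by
  have key : ∀ x, oneSided (x, true) ≠ oneSided (x, false) := by
    intro x h
    obtain ⟨t, rfl⟩ := QuotientAddGroup.mk_surjective x
    rw [oneSided_true, oneSided_false] at h
    obtain ⟨r, hr⟩ := exists_local_inverse t
    have h1 : ∀ s : Set ℝ,
        map r (map (fun u : ℝ => (u : UnitAddCircle)) (𝓝[s] t)) = 𝓝[s] t := by
      intro s
      rw [map_map]
      conv_rhs => rw [← map_id (f := 𝓝[s] t)]
      exact Filter.map_congr (hr.filter_mono nhdsWithin_le_nhds)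
    have h2 : 𝓝[>] t = 𝓝[<] t := by rw [← h1 (Ioi t), h, h1]
    have h3 : Ioi t ∩ Iio t ∈ 𝓝[<] t := inter_mem (h2 ▸ self_mem_nhdsWithin) self_mem_nhdsWithin
    obtain ⟨y, hy⟩ := Filter.nonempty_of_mem h3
    exact lt_irrefl t (lt_trans (b := y) hy.1 hy.2)
  rintro ⟨x, b⟩ ⟨y, d⟩ h
  obtain rfl : y = x :=
    fst_eq_of_map_oneSided_eq (f := id) (p := (x, b)) (q := (y, d)) continuousAt_id (by rwa [map_id])
  cases b <;> cases d
  · rfl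
  · exact absurd h.symm (key y)
  · exact absurd h (key y)
  · rfl

/-- On an arc of length at most one on which it is continuous, a permutation of the circle is
given by a continuous and bounded, strictly increasing or decreasing, real function. -/
theorem exists_real_lift (f : Equiv.Perm UnitAddCircle) {a b : ℝ} (hab : a < b) (hb : b ≤ a + 1)
    (hf : ∀ u ∈ Ioo a b, ContinuousAt f (u : UnitAddCircle)) :
    ∃ (g : ℝ → ℝ) (s : ℝ), ContinuousOn g (Ioo a b) ∧ g '' Ioo a b ⊆ Icc s (s + 1) ∧
      (StrictMonoOn g (Ioo a b) ∨ StrictAntiOn g (Ioo a b)) ∧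
      ∀ u ∈ Ioo a b, f (u : UnitAddCircle) = (g u : UnitAddCircle) := by
  have hinj : InjOn (fun u : ℝ => (u : UnitAddCircle)) (Ioc a b) := by
    intro u hu v hv huv
    exact (AddCircle.coe_eq_coe_iff_of_mem_Ioc (p := 1) (a := a) ⟨hu.1, hu.2.trans hb⟩
      ⟨hv.1, hv.2.trans hb⟩).1 huv
  -- the value at `b` is omitted on the open arc, so that the image lies in a chart
  obtain ⟨s, hs⟩ := QuotientAddGroup.mk_surjective (f (b : UnitAddCircle))
  let e := AddCircle.openPartialHomeomorphCoe (1 : ℝ) s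
  have ht : ∀ u ∈ Ioo a b, f (u : UnitAddCircle) ∈ e.target := by
    intro u hu h
    have h' : f (u : UnitAddCircle) = f (b : UnitAddCircle) := h.trans hs
    exact hu.2.ne (hinj ⟨hu.1, hu.2.le⟩ ⟨hab, le_rfl⟩ (f.injective h'))
  have hc : ContinuousOn (fun u : ℝ => e.symm (f (u : UnitAddCircle))) (Ioo a b) := by
    intro u hu
    have h4 : ContinuousAt (fun t : ℝ => f (t : UnitAddCircle)) u :=
      ContinuousAt.comp (f := fun t : ℝ => (t : UnitAddCircle)) (g := f) (hf u hu)
        (AddCircle.continuous_mk' 1).continuousAt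
    exact (ContinuousAt.comp (g := e.symm) (f := fun t : ℝ => f (t : UnitAddCircle))
      (e.continuousAt_symm (ht u hu)) h4).continuousWithinAt
  have hi : InjOn (fun u : ℝ => e.symm (f (u : UnitAddCircle))) (Ioo a b) := by
    intro u hu v hv huv
    exact hinj ⟨hu.1, hu.2.le⟩ ⟨hv.1, hv.2.le⟩
      (f.injective (e.symm.injOn (ht u hu) (ht v hv) huv))
  refine ⟨_, s, hc, ?_, hc.strictMonoOn_of_injOn_Ioo hab hi, fun u hu => (e.right_inv (ht u hu)).symm⟩
  rintro _ ⟨u, hu, rfl⟩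
  exact Ioo_subset_Icc_self (e.map_target (ht u hu))

theorem map_oneSided_true_of_lift {f : UnitAddCircle → UnitAddCircle} {g : ℝ → ℝ} {a b : ℝ}
    {F : Filter ℝ} (hab : a < b)
    (hfg : ∀ u ∈ Ioo a b, f (u : UnitAddCircle) = (g u : UnitAddCircle))
    (h : map g (𝓝[>] a) = F) :
    map f (oneSided ((a : UnitAddCircle), true)) = map (fun u : ℝ => (u : UnitAddCircle)) F := by
  rw [oneSided_true, ← h, map_map, map_map]
  apply Filter.map_congr
  filter_upwards [Ioo_mem_nhdsGT hab] with u hu using hfg u hu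

/-- A piecewise continuous permutation sends one-sided punctured neighbourhoods to one-sided
punctured neighbourhoods, also at its discontinuities. -/
theorem exists_map_oneSided_eq {f : Equiv.Perm UnitAddCircle} (hf : f ∈ PCHat)
    (p : UnitAddCircle × Bool) : ∃ q, map f (oneSided p) = oneSided q := by
  obtain ⟨F, hF⟩ := hf
  have hev := F.eventually_cofinite_notMem.filter_mono (oneSided_le_cofinite p)
  obtain ⟨x, d⟩ := p
  obtain ⟨t, rfl⟩ := QuotientAddGroup.mk_surjective x
  cases d
  · change ∀ᶠ y in oneSided ((t : UnitAddCircle), false), y ∉ F at hev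
    change ∃ q, map f (oneSided ((t : UnitAddCircle), false)) = oneSided q
    rw [oneSided_false] at hev ⊢
    obtain ⟨a, hab, ha⟩ := (mem_nhdsLT_iff_exists_mem_Ico_Ioo_subset (sub_one_lt t)).1 hev
    obtain ⟨g, s, hc, hgs, hg, hfg⟩ := exists_real_lift f hab.2 (by linarith [hab.1])
      fun u hu => hF _ (ha hu)
    have hneg : MapsTo (fun u : ℝ => -u) (Ioo (-t) (-a)) (Ioo a t) := fun u hu =>
      ⟨by linarith [hu.2], by linarith [hu.1]⟩
    have hc' : ContinuousOn (fun u => g (-u)) (Ioo (-t) (-a)) := hc.comp continuousOn_neg hneg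
    have him : (fun u => g (-u)) '' Ioo (-t) (-a) ⊆ Icc s (s + 1) := by
      rintro _ ⟨u, hu, rfl⟩
      exact hgs ⟨-u, hneg hu, rfl⟩
    have hmap : map f (map (fun u : ℝ => (u : UnitAddCircle)) (𝓝[<] t)) =
        map (fun u : ℝ => (u : UnitAddCircle)) (map g (𝓝[<] t)) := by
      rw [map_map, map_map]
      apply Filter.map_congr
      filter_upwards [Ioo_mem_nhdsLT hab.2] with u hu using hfg u hu
    rw [hmap]
    rcases hg with hg | hg
    · obtain ⟨c, h⟩ := map_nhdsGT_of_strictAntiOn (neg_lt_neg hab.2) hc'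
        (fun u hu v hv huv => hg (hneg hv) (hneg hu) (neg_lt_neg huv)) (bddAbove_Icc.mono him)
      exact ⟨((c : UnitAddCircle), false), by rw [map_nhdsLT_of_comp_neg h, oneSided_false]⟩
    · obtain ⟨c, h⟩ := map_nhdsGT_of_strictMonoOn (neg_lt_neg hab.2) hc'
        (fun u hu v hv huv => hg (hneg hv) (hneg hu) (neg_lt_neg huv)) (bddBelow_Icc.mono him)
      exact ⟨((c : UnitAddCircle), true), by rw [map_nhdsLT_of_comp_neg h, oneSided_true]⟩
  · change ∀ᶠ y in oneSided ((t : UnitAddCircle), true), y ∉ F at hev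
    change ∃ q, map f (oneSided ((t : UnitAddCircle), true)) = oneSided q
    rw [oneSided_true] at hev
    obtain ⟨b, hab, hb⟩ := (mem_nhdsGT_iff_exists_mem_Ioc_Ioo_subset (lt_add_one t)).1 hev
    obtain ⟨g, s, hc, hgs, hg, hfg⟩ := exists_real_lift f hab.1 hab.2 fun u hu => hF _ (hb hu)
    rcases hg with hg | hg
    · obtain ⟨c, h⟩ := map_nhdsGT_of_strictMonoOn hab.1 hc hg (bddBelow_Icc.mono hgs)
      exact ⟨((c : UnitAddCircle), true), by
        rw [map_oneSided_true_of_lift hab.1 hfg h, oneSided_true]⟩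
    · obtain ⟨c, h⟩ := map_nhdsGT_of_strictAntiOn hab.1 hc hg (bddAbove_Icc.mono hgs)
      exact ⟨((c : UnitAddCircle), false), by
        rw [map_oneSided_true_of_lift hab.1 hfg h, oneSided_false]⟩

/-- On an arc of continuity, the points at which a permutation flips the two sides are fixed points
of a decreasing map, one for each of finitely many lifts. -/
theorem finite_flips_Ioo (f : Equiv.Perm UnitAddCircle) {a b : ℝ} (hb : b ≤ a + 1)
    (hf : ∀ u ∈ Ioo a b, ContinuousAt f (u : UnitAddCircle)) :
    {u ∈ Ioo a b | map f (oneSided ((u : UnitAddCircle), true)) =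
      oneSided ((u : UnitAddCircle), false)}.Finite := by
  rcases le_or_gt b a with hab | hab
  · simp [Ioo_eq_empty_of_le hab]
  obtain ⟨g, s, hc, hgs, hg, hfg⟩ := exists_real_lift f hab hb hf
  rcases hg with hg | hg
  · convert finite_empty
    refine eq_empty_of_forall_notMem ?_
    rintro u ⟨hu, h⟩
    have hsub : Ioo u b ⊆ Ioo a b := Ioo_subset_Ioo_left hu.1.le
    obtain ⟨c, h1⟩ := map_nhdsGT_of_strictMonoOn hu.2 (hc.mono hsub) (hg.mono hsub)
      (bddBelow_Icc.mono ((image_mono hsub).trans hgs))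
    rw [map_oneSided_true_of_lift hu.2 (fun v hv => hfg v (hsub hv)) h1, ← oneSided_true] at h
    exact absurd (congrArg Prod.snd (oneSided_injective h)) (by simp)
  · have hfin : (⋃ k ∈ Icc ⌊s - b⌋ ⌈s + 1 - a⌉, {u ∈ Ioo a b | g u = u + (k : ℤ)}).Finite := by
      refine (finite_Icc _ _).biUnion fun k _ => Set.Subsingleton.finite ?_
      rintro u ⟨hu, hu'⟩ v ⟨hv, hv'⟩
      rcases lt_trichotomy u v with h | h | h
      · have := hg hu hv h
        linarith
      · exact h
      · have := hg hv hu h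
        linarith
    refine hfin.subset ?_
    rintro u ⟨hu, h⟩
    have h1 : (u : UnitAddCircle) = f u :=
      fst_eq_of_map_oneSided_eq (p := ((u : UnitAddCircle), true)) (q := ((u : UnitAddCircle), false))
        (hf u hu) h
    rw [hfg u hu, eq_comm, ← sub_eq_zero, ← AddCircle.coe_sub, AddCircle.coe_eq_zero_iff] at h1
    obtain ⟨k, hk⟩ := h1
    rw [zsmul_one] at hk
    have h2 := hgs ⟨u, hu, rfl⟩
    refine mem_iUnion₂.2 ⟨k, ⟨?_, ?_⟩, hu, by linarith⟩
    · refine Int.cast_le (R := ℝ).1 ((Int.floor_le _).trans ?_)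
      linarith [h2.1, hu.2]
    · refine Int.cast_le (R := ℝ).1 (le_trans ?_ (Int.le_ceil _))
      linarith [h2.2, hu.1]

/-- By compactness of the circle, finiteness of the flips is a local question on either side of each
point. -/
theorem finite_flips {f : Equiv.Perm UnitAddCircle} (hf : f ∈ PCHat) :
    {x | map f (oneSided (x, true)) = oneSided (x, false)}.Finite := by
  obtain ⟨F, hF⟩ := hf
  let Z : Set ℝ := {u | map f (oneSided ((u : UnitAddCircle), true)) =
      oneSided ((u : UnitAddCircle), false)}
  have hcpt : (Icc (0 : ℝ) 1 ∩ Z).Finite := by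
    refine isCompact_Icc.induction_on (p := fun s => (s ∩ Z).Finite) (by simp)
      (fun s t hst ht => ht.subset (inter_subset_inter_left _ hst))
      (fun s t hs ht => by rw [union_inter_distrib_right]; exact hs.union ht) fun t _ => ?_
    have hr := F.eventually_cofinite_notMem.filter_mono
      (oneSided_le_cofinite ((t : UnitAddCircle), true))
    have hl := F.eventually_cofinite_notMem.filter_mono
      (oneSided_le_cofinite ((t : UnitAddCircle), false))
    rw [oneSided_true] at hr
    rw [oneSided_false] at hl
    obtain ⟨b, hb, hbF⟩ := (mem_nhdsGT_iff_exists_mem_Ioc_Ioo_subset (lt_add_one t)).1 hr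
    obtain ⟨a, ha, haF⟩ := (mem_nhdsLT_iff_exists_mem_Ico_Ioo_subset (sub_one_lt t)).1 hl
    refine ⟨Ioo a b, nhdsWithin_le_nhds (Ioo_mem_nhds ha.2 hb.1), ?_⟩
    have h1 := finite_flips_Ioo f (by linarith [ha.1]) fun u hu => hF _ (haF hu)
    have h2 := finite_flips_Ioo f hb.2 fun u hu => hF _ (hbF hu)
    refine ((h1.union h2).union (finite_singleton t)).subset ?_
    rintro u ⟨hu, huZ⟩
    rcases lt_trichotomy u t with h | h | h
    · exact Or.inl (Or.inl ⟨⟨hu.1, h⟩, huZ⟩)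
    · exact Or.inr h
    · exact Or.inl (Or.inr ⟨⟨h, hu.2⟩, huZ⟩)
  refine (hcpt.image fun u : ℝ => (u : UnitAddCircle)).subset fun x hx => ?_
  obtain ⟨t, rfl⟩ := QuotientAddGroup.mk_surjective x
  have hfr : ((Int.fract t : ℝ) : UnitAddCircle) = (t : UnitAddCircle) := by
    rw [eq_comm, ← sub_eq_zero, ← AddCircle.coe_sub, AddCircle.coe_eq_zero_iff]
    exact ⟨⌊t⌋, by rw [zsmul_one, Int.self_sub_fract]⟩
  refine ⟨Int.fract t, ⟨⟨Int.fract_nonneg t, (Int.fract_lt_one t).le⟩, ?_⟩, hfr⟩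
  change map f (oneSided (((Int.fract t : ℝ) : UnitAddCircle), true)) =
    oneSided (((Int.fract t : ℝ) : UnitAddCircle), false)
  rw [hfr]
  exact hx

/-! ### The action on one-sided neighbourhoods -/

/-- The action of piecewise continuous permutations on the one-sided punctured neighbourhoods of
the points of the circle. -/
noncomputable instance PCHat.instMulActionSides : MulAction PCHat (UnitAddCircle × Bool) where
  smul f p := (exists_map_oneSided_eq f.2 p).choose
  one_smul p := oneSided_injective
    (((exists_map_oneSided_eq (1 : PCHat).2 p).choose_spec).symm.trans map_id)
  mul_smul f g p := by
    apply oneSided_injective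
    refine ((exists_map_oneSided_eq (f * g).2 p).choose_spec).symm.trans ?_
    refine Eq.trans ?_ (exists_map_oneSided_eq f.2 _).choose_spec
    refine Eq.trans ?_
      (congrArg (map (f : Equiv.Perm UnitAddCircle)) (exists_map_oneSided_eq g.2 p).choose_spec)
    rw [map_map]
    rfl

theorem map_oneSided (f : PCHat) (p : UnitAddCircle × Bool) :
    map (f : Equiv.Perm UnitAddCircle) (oneSided p) = oneSided (f • p) :=
  (exists_map_oneSided_eq f.2 p).choose_spec

/-- The permutation representation of `PC` on one-sided punctured neighbourhoods: finitely supported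
permutations act trivially. -/
noncomputable def PC.sideHom : PC →* Equiv.Perm (UnitAddCircle × Bool) :=
  QuotientGroup.lift _ (MulAction.toPermHom PCHat (UnitAddCircle × Bool)) (by
    intro f hf
    have hf' : {x | (f : Equiv.Perm UnitAddCircle) x ≠ x}.Finite := hf
    ext1 p
    apply oneSided_injective
    change oneSided (f • p) = oneSided p
    rw [← map_oneSided]
    have h : (f : UnitAddCircle → UnitAddCircle) =ᶠ[oneSided p] id :=
      Filter.Eventually.filter_mono (oneSided_le_cofinite p)
        (by simpa [eventually_cofinite] using hf')
    rw [Filter.map_congr h, map_id])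

theorem PC.proj_eq_iff {f g : PCHat} : PC.proj f = PC.proj g ↔
    {x | (f : Equiv.Perm UnitAddCircle) x ≠ (g : Equiv.Perm UnitAddCircle) x}.Finite := by
  have h : PC.proj f = PC.proj g ↔ f⁻¹ * g ∈ (finSuppPerm UnitAddCircle).subgroupOf PCHat :=
    QuotientGroup.eq
  rw [h, Subgroup.mem_subgroupOf]
  change {x | (f : Equiv.Perm UnitAddCircle).symm ((g : Equiv.Perm UnitAddCircle) x) ≠ x}.Finite ↔ _
  simp only [ne_eq, Equiv.symm_apply_eq]
  simp only [eq_comm]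

/-! ### Realization in the circle -/

theorem theorem1 (A : Subgroup PC) (hfg : A.FG) (hab : ∀ g ∈ A, ∀ h ∈ A, g * h = h * g) :
    PC.Realizable A := by
  let : CommGroup A := { (inferInstance : Group A) with
    mul_comm := fun g h => Subtype.ext (hab g g.2 h h.2) }
  have : Group.FG A := (Group.fg_iff_subgroup_fg A).2 hfg
  let : MulAction A (UnitAddCircle × Bool) :=
    MulAction.compHom _ (PC.sideHom.comp A.subtype)
  choose f hf using fun a : A => QuotientGroup.mk'_surjective _ (a : PC)
  have hsmul : ∀ (a : A) (p : UnitAddCircle × Bool), a • p = f a • p := by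
    intro a p
    change PC.sideHom (a : PC) p = _
    rw [← hf a]
    rfl
  obtain ⟨τ, hτ⟩ := exists_hom_perm_near (A := A) (X := UnitAddCircle)
    (fun a => (f a : Equiv.Perm UnitAddCircle)) (by
      intro a
      obtain ⟨F, hF⟩ := (f a).2
      refine (F.finite_toSet.prod (finite_univ (α := Bool))).subset ?_
      rintro ⟨x, b⟩ hx
      refine ⟨?_, mem_univ _⟩
      by_contra hxF
      apply hx
      rw [hsmul]
      exact fst_eq_of_map_oneSided_eq (hF x hxF) (map_oneSided (f a) (x, b))) (by
      have hflip : ∀ a : A, {x : UnitAddCircle | a • (x, true) = (x, false)}.Finite := by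
        intro a
        refine (finite_flips (f a).2).subset fun x hx => ?_
        have hx : a • (x, true) = (x, false) := hx
        change map _ _ = _
        rw [map_oneSided, ← hsmul, hx]
      intro a
      refine (((hflip a).union (hflip a⁻¹)).prod (finite_univ (α := Bool))).subset ?_
      rintro ⟨x, b⟩ hx
      refine ⟨?_, mem_univ _⟩
      have hx : a • (x, b) = (x, !b) := hx
      cases b
      · exact Or.inr (inv_smul_eq_iff.2 hx.symm)
      · exact Or.inl hx)
  have hmem : ∀ a, τ a ∈ PCHat := by
    intro a
    have h : (f a : Equiv.Perm UnitAddCircle)⁻¹ * τ a ∈ finSuppPerm UnitAddCircle := by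
      refine (hτ a).subset fun x hx h => hx ?_
      change (f a : Equiv.Perm UnitAddCircle).symm (τ a x) = x
      rw [Equiv.symm_apply_eq]
      exact h
    have h1 := mul_mem (f a).2 (finSuppPerm_le_PCHat h)
    rwa [mul_inv_cancel_left] at h1
  let T : A →* PCHat := τ.codRestrict PCHat hmem
  have hT : ∀ a, PC.proj (T a) = a := by
    intro a
    rw [← hf a]
    exact PC.proj_eq_iff.2 (hτ a)
  refine ⟨T.range, ?_, ?_, ?_⟩
  · rintro _ ⟨a, rfl⟩
    rw [hT]
    exact a.2
  · rintro _ ⟨a, rfl⟩ _ ⟨b, rfl⟩ h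
    rw [hT, hT] at h
    rw [Subtype.ext h]
  · intro a ha
    exact ⟨T ⟨a, ha⟩, ⟨_, rfl⟩, hT _⟩
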